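/- Let $\mathcal C$ and $\mathcal D$ be symmetric monoidal model categories (closed symmetric monoidal categories with a model structure satisfying the pushout-product axiom and the unit condition), let $\mathcal M$ be a $\mathcal C$-model category and $\mathcal N$ a $\mathcal D$-model category (tensored, cotensored and enriched, with the pushout-product axiom and the unit condition), with mapping objects $\underline{\mathcal M}_{\mathcal C}(X,Y)\in\mathcal C$ and $\underline{\mathcal N}_{\mathcal D}(X,Y)\in\mathcal D$. Let $F\colon\mathcal C\rightleftarrows\mathcal D\colon G$ and $L\colon\mathcal M\rightleftarrows\mathcal N\colon R$ be Quillen pairs, with left adjoints $F$ and $L$, where $G$ is lax symmetric monoidal. Suppose that $(L,R)$ is a Quillen equivalence and a *Quillen adjoint module* over $(F,G)$: there is a natural transformation $\gamma\colon L(X\otimes c)\to LX\otimes Fc$ ($X\in\mathcal M$, $c\in\mathcal C$) that is a weak equivalence whenever $X$ and $c$ are cofibrant and that is compatible with the associativity and unit isomorphisms, i.e. the two composites $L(X\otimes(c\otimes c'))\cong L((X\otimes c)\otimes c')\to L(X\otimes c)\otimes Fc'\to(LX\otimes Fc)\otimes Fc'$ and $L(X\otimes(c\otimes c'))\to LX\otimes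 F(c\otimes c')\to LX\otimes(Fc\otimes Fc')\cong(LX\otimes Fc)\otimes Fc'$ agree, and the composite $LX\cong L(X\otimes\mathbf 1_{\mathcal C})\to LX\otimes F(\mathbf 1_{\mathcal C})\to LX\otimes\mathbf 1_{\mathcal D}$ is the unit isomorphism; here $F(c\otimes c')\to Fc\otimes Fc'$ and $F(\mathbf 1_{\mathcal C})\to\mathbf 1_{\mathcal D}$ are adjoint to the lax monoidal structure of $G$. A *$\mathcal C$-model enrichment* of a model category $\mathcal P$ is a bifunctor $\sigma\colon\mathcal P^{op}\times\mathcal P\to\mathcal C$ with associative and unital composition pairings $\sigma(Y,Z)\otimes\sigma(X,Y)\to\sigma(X,Z)$, natural in $X$ and $Z$, and units $\mathbf 1\to\sigma(X,X)$ that for each $X\to Y$ agree after mapping to $\sigma(X,Y)$ from $\sigma(X,X)$ and from $\sigma(Y,Y)$, such that $\sigma(X,-)$ takes weak equivalences between fibrant objects to weak equivalences for $X$ cofibrant, and $\sigma(-,Y)$ takes weak equivalences between cofibrant objects to weak equivalences for $Y$ fibrant. A *pointed $\sigma$-$\tau$ bimodule* $B$ consists of objects $B(a,b)\in\mathcal C$,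 bifunctorial in $(a,b)\in\mathcal P^{op}\times\mathcal P$, with associative, unital and commuting actions $\sigma(b,c)\otimes B(a,b)\to B(a,c)$ and $B(b,c)\otimes\tau(a,b)\to B(a,c)$, natural in $a$ and $c$, and points $\mathbf 1\to B(a,a)$ that for each $a\to b$ agree in $B(a,b)$ with those of $B(b,b)$. It is a *quasi-equivalence* if the induced maps $\sigma(a,b)\to B(a,b)$ and $\tau(a,b)\to B(a,b)$ are weak equivalences for all cofibrant $a$ and fibrant $b$. Two $\mathcal C$-model enrichments are *quasi-equivalent* if they are related by the equivalence relation generated by the existence of a quasi-equivalence between model enrichments. Let $\mathcal Q$ be a cofibrant-replacement functor on $\mathcal M$, with natural trivial fibrations $\mathcal QW\to W$, and $\mathcal F$ a fibrant-replacement functor on $\mathcal N$, with natural trivial cofibrations $W\to\mathcal FW$. Then $$X,Y\mapsto G\,\underline{\mathcal N}_{\mathcal D}(X,Y)\qquad\text{and}\qquad X,Y\mapsto\underline{\mathcal M}_{\mathcal C}(\mathcal QR\mathcal FX,\mathcal QR\mathcal FY)$$ are $\mathcal C$-model enrichments of $\mathcal N$ and are quasi-equivalent; the second one is, by definition, $L_*\underline{\mathcal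 M}_{\mathcal C}$, so $L_*\underline{\mathcal M}_{\mathcal C}\simeq G\,\underline{\mathcal N}_{\mathcal D}$. If moreover $R$ preserves all weak equivalences, then $X,Y\mapsto\underline{\mathcal M}_{\mathcal C}(\mathcal QRX,\mathcal QRY)$ is a $\mathcal C$-model enrichment of $\mathcal N$ that is quasi-equivalent to both of them. -/

import Mathlib

open CategoryTheory MonoidalCategory HomotopicalAlgebra Opposite
open CategoryTheory.MonoidalCategory.MonoidalRightAction

universe v₁ v₂ v₃ v₄ u₁ u₂ u₃ u₄

namespace EnrichedModel

section Quillen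

variable {M : Type u₁} [Category.{v₁} M] [ModelCategory M]
  {N : Type u₂} [Category.{v₂} N] [ModelCategory N]
  {P : Type u₃} [Category.{v₃} P] [ModelCategory P]

/-- An adjunction between model categories is a Quillen pair if its left adjoint preserves
cofibrations and trivial cofibrations. -/
structure IsQuillenPair {L : M ⥤ N} {R : N ⥤ M} (_adj : L ⊣ R) : Prop where
  cofibration {X Y : M} (i : X ⟶ Y) [Cofibration i] : Cofibration (L.map i)
  weakEquivalence {X Y : M} (i : X ⟶ Y) [Cofibration i] [WeakEquivalence i] :
    WeakEquivalence (L.map i)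

/-- A Quillen equivalence: a Quillen pair such that, for `X` cofibrant and `Y` fibrant, a map
`L X ⟶ Y` is a weak equivalence if and only if the adjoint map `X ⟶ R Y` is one. -/
structure IsQuillenEquivalence {L : M ⥤ N} {R : N ⥤ M} (adj : L ⊣ R) : Prop extends
    IsQuillenPair adj where
  weakEquivalence_iff {X : M} {Y : N} [IsCofibrant X] [IsFibrant Y] (f : L.obj X ⟶ Y) :
    WeakEquivalence f ↔ WeakEquivalence (adj.homEquiv X Y f)

/-- The pushout-product axiom (the analogue of SM7) for a bifunctor `B` between model categories:
the pushout-product of two cofibrations is a cofibration, which is trivial if one of the two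
given cofibrations is. -/
structure PushoutProductAxiom (B : M ⥤ N ⥤ P) : Prop where
  cofibration {X Y : M} {X' Y' : N} (i : X ⟶ Y) (j : X' ⟶ Y') [Cofibration i] [Cofibration j]
    (sq : B.PushoutObjObj i j) : Cofibration sq.ι
  weakEquivalence_left {X Y : M} {X' Y' : N} (i : X ⟶ Y) (j : X' ⟶ Y')
    [Cofibration i] [WeakEquivalence i] [Cofibration j]
    (sq : B.PushoutObjObj i j) : WeakEquivalence sq.ι
  weakEquivalence_right {X Y : M} {X' Y' : N} (i : X ⟶ Y) (j : X' ⟶ Y')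
    [Cofibration i] [Cofibration j] [WeakEquivalence j]
    (sq : B.PushoutObjObj i j) : WeakEquivalence sq.ι

variable (M) in
/-- A cofibrant-replacement functor: a functor `Q` with natural trivial fibrations `Q X ⟶ X` from
cofibrant objects. -/
structure CofibrantReplacement where
  /-- the replacement functor -/
  Q : M ⥤ M
  /-- the natural map to the identity -/
  π : Q ⟶ 𝟭 M
  isCofibrant (X : M) : IsCofibrant (Q.obj X)
  fibration (X : M) : Fibration (π.app X)
  weakEquivalence (X : M) : WeakEquivalence (π.app X)

variable (M) in
/-- A fibrant-replacement functor: a functor `Fib` with natural trivial cofibrations `X ⟶ Fib X`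
to fibrant objects. -/
structure FibrantReplacement where
  /-- the replacement functor -/
  Fib : M ⥤ M
  /-- the natural map from the identity -/
  ι : 𝟭 M ⟶ Fib
  isFibrant (X : M) : IsFibrant (Fib.obj X)
  cofibration (X : M) : Cofibration (ι.app X)
  weakEquivalence (X : M) : WeakEquivalence (ι.app X)

end Quillen

/-- A symmetric monoidal model category: a closed symmetric monoidal category with a model
structure satisfying the pushout-product axiom and the unit condition. -/
class SymmetricMonoidalModelCategory (C : Type u₁) [Category.{v₁} C] [MonoidalCategory C]
    [SymmetricCategory C] [MonoidalClosed C] [ModelCategory C] : Prop where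
  pushoutProduct : PushoutProductAxiom (curriedTensor C)
  whiskerRight_weakEquivalence {A : C} (q : A ⟶ 𝟙_ C) [IsCofibrant A] [Fibration q]
    [WeakEquivalence q] (X : C) [IsCofibrant X] : WeakEquivalence (q ▷ X)
  whiskerLeft_weakEquivalence {A : C} (q : A ⟶ 𝟙_ C) [IsCofibrant A] [Fibration q]
    [WeakEquivalence q] (X : C) [IsCofibrant X] : WeakEquivalence (X ◁ q)

/-- A closed `C`-module category: a category `M` with a coherent right action
`X, c ↦ X ⊙ᵣ c` of `C`, with cotensors `F(c, Z)` and mapping objects in `C`, and with natural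
isomorphisms `M(X ⊙ᵣ c, Z) ≅ M(X, F(c, Z)) ≅ C(c, Hom(X, Z))`. -/
class ClosedModule (C : Type u₁) [Category.{v₁} C] [MonoidalCategory C]
    (M : Type u₂) [Category.{v₂} M] extends MonoidalRightAction C M where
  /-- the mapping objects -/
  ehom : Mᵒᵖ ⥤ M ⥤ C
  /-- the cotensors -/
  cotensor : Cᵒᵖ ⥤ M ⥤ M
  /-- `M(X ⊙ᵣ c, Z) ≅ C(c, Hom(X, Z))` -/
  ehomAdj : (curriedAction C M).flip ⊣₂ ehom
  /-- `M(X ⊙ᵣ c, Z) ≅ M(X, F(c, Z))` -/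
  cotensorAdj : curriedAction C M ⊣₂ cotensor

/-- A `C`-model category: a model category that is a closed `C`-module category and satisfies the
pushout-product axiom and the unit condition. -/
class IsModuleModelCategory (C : Type u₁) [Category.{v₁} C] [MonoidalCategory C] [ModelCategory C]
    (M : Type u₂) [Category.{v₂} M] [ModelCategory M] [ClosedModule C M] : Prop where
  pushoutProduct : PushoutProductAxiom (curriedAction C M)
  unit_weakEquivalence {A : C} (q : A ⟶ 𝟙_ C) [IsCofibrant A] [Fibration q]
    [WeakEquivalence q] (X : M) [IsCofibrant X] : WeakEquivalence (X ⊴ᵣ q)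

/-- An enrichment of `M` by `C`: a bifunctor `σ : Mᵒᵖ × M → C` with associative and unital
composition pairings `σ(Y, Z) ⊗ σ(X, Y) ⟶ σ(X, Z)`, natural in `X` and `Z`, whose units are
compatible with the bifunctor structure. -/
structure Enrichment (C : Type u₁) [Category.{v₁} C] [MonoidalCategory C]
    (M : Type u₂) [Category.{v₂} M] where
  /-- the bifunctor -/
  hom : Mᵒᵖ ⥤ M ⥤ C
  /-- the composition pairings -/
  comp (X Y Z : M) :
    (hom.obj (op Y)).obj Z ⊗ (hom.obj (op X)).obj Y ⟶ (hom.obj (op X)).obj Z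
  /-- the units -/
  unit (X : M) : 𝟙_ C ⟶ (hom.obj (op X)).obj X
  comp_natural_left {X' X : M} (f : X' ⟶ X) (Y Z : M) :
    comp X Y Z ≫ (hom.map f.op).app Z =
      (hom.obj (op Y)).obj Z ◁ (hom.map f.op).app Y ≫ comp X' Y Z
  comp_natural_right (X Y : M) {Z Z' : M} (g : Z ⟶ Z') :
    comp X Y Z ≫ (hom.obj (op X)).map g =
      (hom.obj (op Y)).map g ▷ (hom.obj (op X)).obj Y ≫ comp X Y Z'
  assoc (W X Y Z : M) :
    comp X Y Z ▷ (hom.obj (op W)).obj X ≫ comp W X Z =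
      (α_ _ _ _).hom ≫ (hom.obj (op Y)).obj Z ◁ comp W X Y ≫ comp W Y Z
  unit_comp (X Y : M) :
    unit Y ▷ (hom.obj (op X)).obj Y ≫ comp X Y Y = (λ_ _).hom
  comp_unit (X Y : M) :
    (hom.obj (op X)).obj Y ◁ unit X ≫ comp X X Y = (ρ_ _).hom
  unit_natural {X Y : M} (f : X ⟶ Y) :
    unit X ≫ (hom.obj (op X)).map f = unit Y ≫ (hom.map f.op).app Y

namespace Enrichment

section

variable {C : Type u₁} [Category.{v₁} C] [MonoidalCategory C]
  {M : Type u₂} [Category.{v₂} M]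

/-- The object `σ(X, Y)` of `C`. -/
abbrev Hom (σ : Enrichment C M) (X Y : M) : C := (σ.hom.obj (op X)).obj Y

/-- Restriction of an enrichment along a functor `T`: the enrichment
`X, Y ↦ σ(T X, T Y)`. -/
def comap (σ : Enrichment C M) {N : Type u₃} [Category.{v₃} N] (T : N ⥤ M) :
    Enrichment C N where
  hom := T.op ⋙ σ.hom ⋙ (Functor.whiskeringLeft N M C).obj T
  comp X Y Z := σ.comp (T.obj X) (T.obj Y) (T.obj Z)
  unit X := σ.unit (T.obj X)
  comp_natural_left f _ _ := σ.comp_natural_left (T.map f) _ _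
  comp_natural_right _ _ _ _ g := σ.comp_natural_right _ _ (T.map g)
  assoc _ _ _ _ := σ.assoc _ _ _ _
  unit_comp _ _ := σ.unit_comp _ _
  comp_unit _ _ := σ.comp_unit _ _
  unit_natural f := σ.unit_natural (T.map f)

open Functor.LaxMonoidal in
/-- The enrichment `X, Y ↦ G (σ(X, Y))` obtained by applying a lax monoidal functor `G`. -/
def mapLax {D : Type u₃} [Category.{v₃} D] [MonoidalCategory D] (σ : Enrichment D M)
    (G : D ⥤ C) [G.LaxMonoidal] : Enrichment C M where
  hom := σ.hom ⋙ (Functor.whiskeringRight M D C).obj G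
  comp X Y Z := μ G _ _ ≫ G.map (σ.comp X Y Z)
  unit X := ε G ≫ G.map (σ.unit X)
  comp_natural_left f Y Z := by
    dsimp
    rw [Category.assoc, ← G.map_comp, σ.comp_natural_left, G.map_comp, μ_natural_right_assoc]
  comp_natural_right X Y _ _ g := by
    dsimp
    rw [Category.assoc, ← G.map_comp, σ.comp_natural_right, G.map_comp, μ_natural_left_assoc]
  assoc W X Y Z := by
    dsimp
    simp only [comp_whiskerRight, MonoidalCategory.whiskerLeft_comp, Category.assoc,
      μ_natural_left_assoc, μ_natural_right_assoc, ← G.map_comp, σ.assoc]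
    simp only [G.map_comp, associativity_assoc]
  unit_comp X Y := by
    dsimp
    simp only [comp_whiskerRight, Category.assoc, μ_natural_left_assoc, ← G.map_comp,
      σ.unit_comp, left_unitality]
  comp_unit X Y := by
    dsimp
    simp only [MonoidalCategory.whiskerLeft_comp, Category.assoc, μ_natural_right_assoc,
      ← G.map_comp, σ.comp_unit, right_unitality]
  unit_natural f := by
    dsimp
    simp only [Category.assoc, ← G.map_comp, σ.unit_natural]

end

end Enrichment

section SelfEnrichment

variable (C : Type u₁) [Category.{v₁} C] [MonoidalCategory C]
  {M : Type u₂} [Category.{v₂} M] [ClosedModule C M]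

/-- The mapping object `Hom_C(X, Y)` in `C` of two objects of a closed `C`-module category. -/
abbrev mapObj (X Y : M) : C := ((ClosedModule.ehom (C := C) (M := M)).obj (op X)).obj Y

/-- The evaluation map `X ⊙ᵣ Hom_C(X, Y) ⟶ Y`. -/
def ev (X Y : M) : X ⊙ᵣ mapObj C X Y ⟶ Y :=
  ((ClosedModule.ehomAdj (C := C) (M := M)).adj X).counit.app Y

variable {C} in
/-- The map `c ⟶ Hom_C(X, Y)` adjoint to a map `X ⊙ᵣ c ⟶ Y`. -/
def curry {X Y : M} {c : C} (f : X ⊙ᵣ c ⟶ Y) : c ⟶ mapObj C X Y :=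
  ((ClosedModule.ehomAdj (C := C) (M := M)).adj X).homEquiv c Y f

variable {C}

lemma curry_ev {X Y : M} {c : C} (f : X ⊙ᵣ c ⟶ Y) : X ⊴ᵣ curry f ≫ ev C X Y = f :=
  (((ClosedModule.ehomAdj (C := C) (M := M)).adj X).homEquiv_counit (g := curry f)).symm.trans
    (Equiv.symm_apply_apply _ f)

lemma mapObj_hom_ext {X Y : M} {c : C} {f g : c ⟶ mapObj C X Y}
    (h : X ⊴ᵣ f ≫ ev C X Y = X ⊴ᵣ g ≫ ev C X Y) : f = g := by
  apply (((ClosedModule.ehomAdj (C := C) (M := M)).adj X).homEquiv c Y).symm.injective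
  rw [Adjunction.homEquiv_counit, Adjunction.homEquiv_counit]
  exact h

lemma map_ev (X : M) {Y Y' : M} (g : Y ⟶ Y') :
    X ⊴ᵣ ((ClosedModule.ehom (C := C) (M := M)).obj (op X)).map g ≫ ev C X Y' =
      ev C X Y ≫ g :=
  ((ClosedModule.ehomAdj (C := C) (M := M)).adj X).counit.naturality g

lemma map_op_ev {X X' : M} (f : X ⟶ X') (Y : M) :
    X ⊴ᵣ ((ClosedModule.ehom (C := C) (M := M)).map f.op).app Y ≫ ev C X Y =
      f ⊵ᵣ mapObj C X' Y ≫ ev C X' Y :=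
  (NatTrans.congr_app
    ((ClosedModule.ehomAdj (C := C) (M := M)).whiskerLeft_map_counit f) Y).symm

/-- Composition `Hom_C(X, Y) ⊗ Hom_C(Y, Z) ⟶ Hom_C(X, Z)` in the diagrammatic order, adjoint to
the iterated evaluation map. -/
def compDiag (X Y Z : M) : mapObj C X Y ⊗ mapObj C Y Z ⟶ mapObj C X Z :=
  curry ((αᵣ X (mapObj C X Y) (mapObj C Y Z)).hom ≫ ev C X Y ⊵ᵣ mapObj C Y Z ≫ ev C Y Z)

lemma compDiag_ev (X Y Z : M) :
    X ⊴ᵣ compDiag (C := C) X Y Z ≫ ev C X Z =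
      (αᵣ X (mapObj C X Y) (mapObj C Y Z)).hom ≫ ev C X Y ⊵ᵣ mapObj C Y Z ≫ ev C Y Z :=
  curry_ev _

lemma actionHomRight_whiskerLeft (X : M) (c : C) {d d' : C} (f : d ⟶ d') :
    X ⊴ᵣ (c ◁ f) = (αᵣ X c d).hom ≫ (X ⊙ᵣ c) ⊴ᵣ f ≫ (αᵣ X c d').inv :=
  MonoidalRightAction.whiskerRight_actionHomLeft c f X

lemma compDiag_assoc (W X Y Z : M) :
    compDiag (C := C) W X Y ▷ mapObj C Y Z ≫ compDiag W Y Z =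
      (α_ _ _ _).hom ≫ mapObj C W X ◁ compDiag X Y Z ≫ compDiag W X Z := by
  apply mapObj_hom_ext
  simp only [actionHomRight_comp, Category.assoc, compDiag_ev]
  rw [actionHomRight_whiskerRight_assoc, reassoc_of% (@actionHomRight_whiskerLeft)]
  simp only [Iso.inv_hom_id_assoc]
  rw [← comp_actionHomLeft_assoc, compDiag_ev, action_exchange_assoc, compDiag_ev]
  simp only [comp_actionHomLeft, Category.assoc]
  rw [actionHomLeft_tensor_assoc]
  simp only [Iso.inv_hom_id_assoc]
  rw [actionHom_associator_assoc]

lemma compDiag_natural_left {X' X : M} (f : X' ⟶ X) (Y Z : M) :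
    compDiag (C := C) X Y Z ≫ ((ClosedModule.ehom (C := C) (M := M)).map f.op).app Z =
      ((ClosedModule.ehom (C := C) (M := M)).map f.op).app Y ▷ mapObj C Y Z ≫
        compDiag X' Y Z := by
  apply mapObj_hom_ext
  simp only [actionHomRight_comp, Category.assoc, compDiag_ev, map_op_ev]
  rw [action_exchange_assoc, compDiag_ev, actionHomRight_whiskerRight_assoc]
  simp only [Iso.inv_hom_id_assoc]
  rw [← comp_actionHomLeft_assoc, map_op_ev, actionHomLeft_tensor_assoc]
  simp only [Category.assoc, Iso.inv_hom_id_assoc, comp_actionHomLeft]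

lemma compDiag_natural_right (X Y : M) {Z Z' : M} (g : Z ⟶ Z') :
    compDiag (C := C) X Y Z ≫ ((ClosedModule.ehom (C := C) (M := M)).obj (op X)).map g =
      mapObj C X Y ◁ ((ClosedModule.ehom (C := C) (M := M)).obj (op Y)).map g ≫
        compDiag X Y Z' := by
  apply mapObj_hom_ext
  simp only [actionHomRight_comp, Category.assoc, compDiag_ev, map_ev]
  rw [reassoc_of% (@compDiag_ev), reassoc_of% (@actionHomRight_whiskerLeft)]
  simp only [Iso.inv_hom_id_assoc]
  rw [action_exchange_assoc, map_ev]

lemma curry_unit_compDiag (X Y : M) :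
    curry (C := C) (ρᵣ X).hom ▷ mapObj C X Y ≫ compDiag X X Y = (λ_ _).hom := by
  apply mapObj_hom_ext
  simp only [actionHomRight_comp, Category.assoc, compDiag_ev]
  rw [actionHomRight_whiskerRight_assoc]
  simp only [Iso.inv_hom_id_assoc]
  rw [← comp_actionHomLeft_assoc, curry_ev, actionHom_leftUnitor_assoc]

lemma compDiag_curry_unit (X Y : M) :
    mapObj C X Y ◁ curry (C := C) (ρᵣ Y).hom ≫ compDiag X Y Y = (ρ_ _).hom := by
  apply mapObj_hom_ext
  simp only [actionHomRight_comp, Category.assoc, compDiag_ev]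
  rw [reassoc_of% (@actionHomRight_whiskerLeft)]
  simp only [Iso.inv_hom_id_assoc]
  rw [action_exchange_assoc, curry_ev, actionHom_rightUnitor_assoc, actionUnitIso_hom_naturality]

variable (C M) in
/-- The enrichment `X, Y ↦ Hom_C(X, Y)` of a closed module category `M` over a symmetric monoidal
category `C`. The pairing `Hom_C(Y, Z) ⊗ Hom_C(X, Y) ⟶ Hom_C(X, Z)` is adjoint to
`X ⊙ᵣ (Hom_C(Y, Z) ⊗ Hom_C(X, Y)) ≅ (X ⊙ᵣ Hom_C(X, Y)) ⊙ᵣ Hom_C(Y, Z) ⟶ Y ⊙ᵣ Hom_C(Y, Z) ⟶ Z`,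
where the first map uses the symmetry of `C`. -/
def homEnrichment [SymmetricCategory C] : Enrichment C M where
  hom := ClosedModule.ehom
  comp X Y Z := (β_ (mapObj C Y Z) (mapObj C X Y)).hom ≫ compDiag X Y Z
  unit X := curry (ρᵣ X).hom
  comp_natural_left f Y Z := by
    rw [Category.assoc, compDiag_natural_left, BraidedCategory.braiding_naturality_right_assoc]
  comp_natural_right X Y _ _ g := by
    rw [Category.assoc, compDiag_natural_right, BraidedCategory.braiding_naturality_left_assoc]
  assoc W X Y Z := by
    rw [comp_whiskerRight, MonoidalCategory.whiskerLeft_comp, Category.assoc, Category.assoc,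
      BraidedCategory.braiding_naturality_left_assoc,
      BraidedCategory.braiding_naturality_right_assoc, compDiag_assoc,
      BraidedCategory.braiding_tensor_left_hom, BraidedCategory.braiding_tensor_right_hom]
    simp only [Category.assoc, Iso.inv_hom_id_assoc]
    rw [← BraidedCategory.yang_baxter_assoc]
    simp
  unit_comp X Y := by
    rw [BraidedCategory.braiding_naturality_left_assoc, compDiag_curry_unit,
      braiding_rightUnitor]
  comp_unit X Y := by
    rw [BraidedCategory.braiding_naturality_right_assoc, curry_unit_compDiag,
      braiding_leftUnitor]
  unit_natural {X Y} f := by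
    apply mapObj_hom_ext
    simp only [actionHomRight_comp, Category.assoc, map_ev, map_op_ev]
    rw [reassoc_of% (@curry_ev), action_exchange_assoc, curry_ev, actionUnitIso_hom_naturality]

end SelfEnrichment

section ModelEnrichment

variable {C : Type u₁} [Category.{v₁} C] [MonoidalCategory C] [ModelCategory C]
  {M : Type u₂} [Category.{v₂} M] [ModelCategory M]

/-- An enrichment of a model category is a model enrichment if it takes weak equivalences between
cofibrant objects in the first variable, and weak equivalences between fibrant objects in the
second one, to weak equivalences, the other variable being fibrant, respectively cofibrant. -/
structure Enrichment.IsModelEnrichment (σ : Enrichment C M) : Prop where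
  weakEquivalence_right (X : M) [IsCofibrant X] {Y Y' : M} [IsFibrant Y] [IsFibrant Y']
    (g : Y ⟶ Y') [WeakEquivalence g] : WeakEquivalence ((σ.hom.obj (op X)).map g)
  weakEquivalence_left {X X' : M} [IsCofibrant X] [IsCofibrant X'] (f : X ⟶ X')
    [WeakEquivalence f] (Y : M) [IsFibrant Y] : WeakEquivalence ((σ.hom.map f.op).app Y)

variable (C M) in
/-- The model enrichments of `M` by `C`. -/
structure ModelEnrichment extends Enrichment C M where
  isModelEnrichment : toEnrichment.IsModelEnrichment

end ModelEnrichment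

section Bimodule

variable {C : Type u₁} [Category.{v₁} C] [MonoidalCategory C]
  {M : Type u₂} [Category.{v₂} M]

/-- A pointed `σ`-`τ` bimodule: a bifunctor `B` with commuting associative and unital actions
`σ(b, c) ⊗ B(a, b) ⟶ B(a, c)` and `B(b, c) ⊗ τ(a, b) ⟶ B(a, c)`, natural in `a` and `c`,
and with compatible points `𝟙_ C ⟶ B(a, a)`. (By the unit and naturality axioms the bifunctor
structure is the one induced by the two actions.) -/
structure PointedBimodule (σ τ : Enrichment C M) where
  /-- the underlying bifunctor -/
  obj : Mᵒᵖ ⥤ M ⥤ C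
  /-- the left action -/
  left (a b c : M) : σ.Hom b c ⊗ (obj.obj (op a)).obj b ⟶ (obj.obj (op a)).obj c
  /-- the right action -/
  right (a b c : M) : (obj.obj (op b)).obj c ⊗ τ.Hom a b ⟶ (obj.obj (op a)).obj c
  left_natural_left {a' a : M} (f : a' ⟶ a) (b c : M) :
    left a b c ≫ (obj.map f.op).app c = σ.Hom b c ◁ (obj.map f.op).app b ≫ left a' b c
  left_natural_right (a b : M) {c c' : M} (g : c ⟶ c') :
    left a b c ≫ (obj.obj (op a)).map g =
      (σ.hom.obj (op b)).map g ▷ (obj.obj (op a)).obj b ≫ left a b c'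
  right_natural_left {a' a : M} (f : a' ⟶ a) (b c : M) :
    right a b c ≫ (obj.map f.op).app c =
      (obj.obj (op b)).obj c ◁ (τ.hom.map f.op).app b ≫ right a' b c
  right_natural_right (a b : M) {c c' : M} (g : c ⟶ c') :
    right a b c ≫ (obj.obj (op a)).map g =
      (obj.obj (op b)).map g ▷ τ.Hom a b ≫ right a b c'
  left_assoc (a b c d : M) :
    σ.comp b c d ▷ (obj.obj (op a)).obj b ≫ left a b d =
      (α_ _ _ _).hom ≫ σ.Hom c d ◁ left a b c ≫ left a c d
  left_unit (a b : M) : σ.unit b ▷ (obj.obj (op a)).obj b ≫ left a b b = (λ_ _).hom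
  right_assoc (a b c d : M) :
    right b c d ▷ τ.Hom a b ≫ right a b d =
      (α_ _ _ _).hom ≫ (obj.obj (op c)).obj d ◁ τ.comp a b c ≫ right a c d
  right_unit (a b : M) : (obj.obj (op a)).obj b ◁ τ.unit a ≫ right a a b = (ρ_ _).hom
  left_right (a b c d : M) :
    left b c d ▷ τ.Hom a b ≫ right a b d =
      (α_ _ _ _).hom ≫ σ.Hom c d ◁ right a b c ≫ left a c d
  /-- the points -/
  point (a : M) : 𝟙_ C ⟶ (obj.obj (op a)).obj a
  point_natural {a b : M} (f : a ⟶ b) :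
    point a ≫ (obj.obj (op a)).map f = point b ≫ (obj.map f.op).app b

/-- A pointed bimodule is a quasi-equivalence if the composites
`σ(a, b) ≅ σ(a, b) ⊗ 𝟙_ C ⟶ σ(a, b) ⊗ B(a, a) ⟶ B(a, b)` and
`τ(a, b) ≅ 𝟙_ C ⊗ τ(a, b) ⟶ B(b, b) ⊗ τ(a, b) ⟶ B(a, b)` are weak equivalences for all
cofibrant `a` and fibrant `b`. -/
structure PointedBimodule.IsQuasiEquivalence [ModelCategory C] [ModelCategory M]
    {σ τ : Enrichment C M} (B : PointedBimodule σ τ) : Prop where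
  left (a b : M) [IsCofibrant a] [IsFibrant b] :
    WeakEquivalence ((ρ_ _).inv ≫ σ.Hom a b ◁ B.point a ≫ B.left a a b)
  right (a b : M) [IsCofibrant a] [IsFibrant b] :
    WeakEquivalence ((λ_ _).inv ≫ B.point b ▷ τ.Hom a b ≫ B.right a b b)

/-- Two enrichments are quasi-equivalent as model enrichments if both of them are model
enrichments and they are related by the equivalence relation on model enrichments that is
generated by the existence of a pointed bimodule which is a quasi-equivalence. -/
def QuasiEquivalent [ModelCategory C] [ModelCategory M] (σ τ : Enrichment C M) : Prop :=
  ∃ (hσ : σ.IsModelEnrichment) (hτ : τ.IsModelEnrichment),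
    Relation.EqvGen
      (fun s t : ModelEnrichment C M =>
        ∃ B : PointedBimodule s.toEnrichment t.toEnrichment, B.IsQuasiEquivalence)
      ⟨σ, hσ⟩ ⟨τ, hτ⟩

/-- The enrichment `L_* σ = (X, Y ↦ σ(Q R Fib X, Q R Fib Y))` induced on `N` by an enrichment `σ`
of `M` and a Quillen pair from `M` to `N` with right adjoint `R`. -/
def Enrichment.pushforward [ModelCategory M] {N : Type u₃} [Category.{v₃} N] [ModelCategory N]
    (σ : Enrichment C M) (R : N ⥤ M) (Q : CofibrantReplacement M) (Fib : FibrantReplacement N) :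
    Enrichment C N :=
  σ.comap (Fib.Fib ⋙ R ⋙ Q.Q)

end Bimodule

section AdjointModule

variable {C : Type u₁} [Category.{v₁} C] [MonoidalCategory C]
  {D : Type u₂} [Category.{v₂} D] [MonoidalCategory D]
  {M : Type u₃} [Category.{v₃} M] [MonoidalRightAction C M]
  {N : Type u₄} [Category.{v₄} N] [MonoidalRightAction D N]

/-- The structure of an adjoint module over `F ⊣ G` (with `G` lax monoidal) on `L ⊣ R`: a natural
transformation `γ : L (X ⊙ᵣ c) ⟶ L X ⊙ᵣ F c` compatible with the associativity and unit
isomorphisms, `F` carrying the lax comonoidal structure adjoint to the lax monoidal structure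
of `G`. -/
structure AdjointModule {F : C ⥤ D} {G : D ⥤ C} (adj : F ⊣ G) [G.LaxMonoidal]
    {L : M ⥤ N} {R : N ⥤ M} (_adj' : L ⊣ R) where
  /-- the natural transformation -/
  γ (X : M) (c : C) : L.obj (X ⊙ᵣ c) ⟶ L.obj X ⊙ᵣ F.obj c
  γ_natural_left {X X' : M} (f : X ⟶ X') (c : C) :
    L.map (f ⊵ᵣ c) ≫ γ X' c = γ X c ≫ L.map f ⊵ᵣ F.obj c
  γ_natural_right (X : M) {c c' : C} (g : c ⟶ c') :
    L.map (X ⊴ᵣ g) ≫ γ X c' = γ X c ≫ L.obj X ⊴ᵣ F.map g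
  γ_assoc (X : M) (c c' : C) :
    letI := adj.leftAdjointOplaxMonoidal
    L.map (αᵣ X c c').hom ≫ γ (X ⊙ᵣ c) c' ≫ γ X c ⊵ᵣ F.obj c' =
      γ X (c ⊗ c') ≫ L.obj X ⊴ᵣ Functor.OplaxMonoidal.δ F c c' ≫ (αᵣ _ _ _).hom
  γ_unit (X : M) :
    letI := adj.leftAdjointOplaxMonoidal
    L.map (ρᵣ[C] X).inv ≫ γ X (𝟙_ C) ≫ L.obj X ⊴ᵣ Functor.OplaxMonoidal.η F =
      (ρᵣ[D] (L.obj X)).inv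

/-- `(L, R)` is a Quillen adjoint module over `(F, G)`: both are Quillen pairs, and there is an
adjoint module structure `γ` such that `L (X ⊙ᵣ c) ⟶ L X ⊙ᵣ F c` is a weak equivalence whenever
`X` and `c` are cofibrant. -/
structure IsQuillenAdjointModule [ModelCategory C] [ModelCategory D] [ModelCategory M]
    [ModelCategory N] {F : C ⥤ D} {G : D ⥤ C} (adj : F ⊣ G) [G.LaxMonoidal]
    {L : M ⥤ N} {R : N ⥤ M} (adj' : L ⊣ R) : Prop where
  isQuillenPair : IsQuillenPair adj
  isQuillenPair' : IsQuillenPair adj'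
  exists_adjointModule : ∃ A : AdjointModule adj adj',
    ∀ (X : M) (c : C) [IsCofibrant X] [IsCofibrant c], WeakEquivalence (A.γ X c)

end AdjointModule

end EnrichedModel

open EnrichedModel

/-!
Write `τ(a, b) = G Hom_D(a, b)` and `σ = Hom_C`.

* The right adjoint `R` is an enriched functor from `τ` to `σ`: the transformation `γ` makes
  `R a ⊙ᵣ τ(a, b)` act on `R b`, and the coherence of `γ` with associativity and units says that the
  resulting maps `τ(a, b) ⟶ σ(R a, R b)` respect composition and units
  (`AdjointModule.functorStruct`).
* Whenever a functor `T` is enriched from `τ` to `σ` and `S ⟶ T` is a natural transformation, the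
  objects `B(a, b) = σ(S a, T b)` form a pointed bimodule between `τ` and `σ(S -, S -)`, whose two
  comparison maps are `τ(a, b) ⟶ σ(T a, T b) ⟶ σ(S a, T b)` and `σ(S a, S b) ⟶ σ(S a, T b)`
  (`Enrichment.bimodule`).
* If `X` is cofibrant and `b` fibrant, the map `τ(L X, b) ⟶ σ(X, R b)` is a weak equivalence. Indeed
  it is conjugate to `γ : L (X ⊙ᵣ c) ⟶ L X ⊙ᵣ F c`, a transformation between left Quillen functors
  of `c` that is a weak equivalence for `c` cofibrant, and conjugates of such transformations are
  weak equivalences on fibrant objects (`weakEquivalence_conjugateEquiv_app`). The latter is proved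
  by comparing homotopy classes of maps from cofibrant objects.

If `R` preserves weak equivalences, the bimodule `σ(Q R a, R b)` is a quasi-equivalence between `τ`
and `σ(Q R -, Q R -)`: for `a` cofibrant, `L Q R a ⟶ a` is a weak equivalence of cofibrant objects.
In general this needs `a` fibrant as well, so one first replaces `τ` by `τ(Fib -, Fib -)`, through
the bimodule `τ(a, Fib b)`, and then uses `σ(Q R Fib a, R Fib b)`.
-/

namespace EnrichedModel

/-! ### Quillen pairs and Ken Brown's lemma -/

namespace IsQuillenPair

open Limits

variable {A : Type u₁} [Category.{v₁} A] [ModelCategory A]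
  {B : Type u₂} [Category.{v₂} B] [ModelCategory B]
  {E : Type u₃} [Category.{v₃} E] [ModelCategory E]
  {L : A ⥤ B} {R : B ⥤ A} {adj : L ⊣ R} (h : IsQuillenPair adj)

include h

lemma map_fibration {X Y : B} (p : X ⟶ Y) [Fibration p] : Fibration (R.map p) := by
  rw [fibration_iff, ← trivialCofibrations_rlp]
  intro U V i hi
  obtain ⟨_, _⟩ := mem_trivialCofibrations_iff i |>.1 hi
  rw [← adj.hasLiftingProperty_iff]
  have := h.cofibration i
  have := h.weakEquivalence i
  infer_instance

lemma map_trivialFibration {X Y : B} (p : X ⟶ Y) [Fibration p] [WeakEquivalence p] :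
    WeakEquivalence (R.map p) := by
  suffices trivialFibrations A (R.map p) from (mem_trivialFibrations_iff _ |>.1 this).2
  rw [← cofibrations_rlp]
  intro U V i hi
  rw [← cofibration_iff] at hi
  rw [← adj.hasLiftingProperty_iff]
  have := h.cofibration i
  infer_instance

lemma isFibrant (Y : B) [IsFibrant Y] : IsFibrant (R.obj Y) := by
  have := adj.rightAdjoint_preservesLimits
  rw [isFibrant_iff_of_isTerminal (R.map (terminal.from Y))
    (terminalIsTerminal.isTerminalObj R _)]
  exact h.map_fibration _

lemma isCofibrant (X : A) [IsCofibrant X] : IsCofibrant (L.obj X) := by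
  have := adj.leftAdjoint_preservesColimits
  rw [isCofibrant_iff_of_isInitial (L.map (initial.to X))
    (initialIsInitial.isInitialObj L _)]
  exact h.cofibration _

/-- Ken Brown's lemma for the left adjoint of a Quillen pair. -/
lemma map_weakEquivalence_left {X Y : A} [IsCofibrant X] [IsCofibrant Y] (f : X ⟶ Y)
    [WeakEquivalence f] : WeakEquivalence (L.map f) := by
  let b : CofibrantBrownFactorization f := Classical.arbitrary _
  have := h.weakEquivalence b.s
  have := h.weakEquivalence b.i
  have : WeakEquivalence (L.map b.p) := by
    apply weakEquivalence_of_precomp_of_fac (f := L.map b.s) (fg := 𝟙 _)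
    rw [← L.map_comp, b.s_p, L.map_id]
  rw [← b.fac, L.map_comp]
  infer_instance

/-- Ken Brown's lemma for the right adjoint of a Quillen pair. -/
lemma map_weakEquivalence_right {X Y : B} [IsFibrant X] [IsFibrant Y] (f : X ⟶ Y)
    [WeakEquivalence f] : WeakEquivalence (R.map f) := by
  let b : FibrantBrownFactorization f := Classical.arbitrary _
  have := h.map_trivialFibration b.r
  have := h.map_trivialFibration b.p
  have : WeakEquivalence (R.map b.i) := by
    apply weakEquivalence_of_postcomp_of_fac (g := R.map b.r) (fg := 𝟙 _)
    rw [← R.map_comp, b.i_r, R.map_id]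
  rw [← b.fac, R.map_comp]
  infer_instance

lemma comp {L' : B ⥤ E} {R' : E ⥤ B} {adj' : L' ⊣ R'} (h' : IsQuillenPair adj') :
    IsQuillenPair (adj.comp adj') where
  cofibration i _ := by
    have := h.cofibration i
    exact h'.cofibration (L.map i)
  weakEquivalence i _ _ := by
    have := h.cofibration i
    have := h.weakEquivalence i
    exact h'.weakEquivalence (L.map i)

/-- Right homotopies between maps out of `L X` are carried by the adjunction to right homotopies,
as `R` preserves path objects of fibrant objects. -/
lemma rightHomotopyRel_homEquiv {X : A} {Y : B} [IsFibrant Y] {f g : L.obj X ⟶ Y}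
    (H : RightHomotopyRel f g) :
    RightHomotopyRel (adj.homEquiv _ _ f) (adj.homEquiv _ _ g) := by
  obtain ⟨P, _, ⟨H⟩⟩ := H.exists_good_pathObject
  have : WeakEquivalence (R.map P.ι) := h.map_weakEquivalence_right P.ι
  exact ⟨{ toPrepathObject := P.toPrepathObject.map R, weakEquivalence_ι := this },
    ⟨{ h := adj.homEquiv _ _ H.h
       h₀ := (adj.homEquiv_naturality_right _ _).symm.trans (by rw [H.h₀])
       h₁ := (adj.homEquiv_naturality_right _ _).symm.trans (by rw [H.h₁]) }⟩⟩

/-- Left homotopies between maps out of a cofibrant `X` are carried by the adjunction to left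
homotopies, as `L` preserves cylinder objects of cofibrant objects. -/
lemma leftHomotopyRel_homEquiv_symm {X : A} {Y : B} [IsCofibrant X] {f g : X ⟶ R.obj Y}
    (H : LeftHomotopyRel f g) :
    LeftHomotopyRel ((adj.homEquiv _ _).symm f) ((adj.homEquiv _ _).symm g) := by
  obtain ⟨P, _, ⟨H⟩⟩ := H.exists_good_cylinder
  have : WeakEquivalence (L.map P.π) := h.map_weakEquivalence_left P.π
  exact ⟨{ toPrecylinder := P.toPrecylinder.map L, weakEquivalence_π := this },
    ⟨{ h := (adj.homEquiv _ _).symm H.h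
       h₀ := (adj.homEquiv_naturality_left_symm _ _).symm.trans (by rw [H.h₀])
       h₁ := (adj.homEquiv_naturality_left_symm _ _).symm.trans (by rw [H.h₁]) }⟩⟩

/-- For `X` cofibrant and `Y` fibrant, homotopy of maps is detected across the adjunction. -/
lemma leftHomotopyRel_iff {X : A} {Y : B} [IsCofibrant X] [IsFibrant Y] {f g : L.obj X ⟶ Y} :
    LeftHomotopyRel (adj.homEquiv _ _ f) (adj.homEquiv _ _ g) ↔ LeftHomotopyRel f g := by
  have := h.isCofibrant X
  have := h.isFibrant Y
  refine ⟨fun H ↦ ?_, fun H ↦ ?_⟩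
  · simpa using h.leftHomotopyRel_homEquiv_symm H
  · rw [leftHomotopyRel_iff_rightHomotopyRel] at H ⊢
    exact h.rightHomotopyRel_homEquiv H

end IsQuillenPair

/-! ### Detecting weak equivalences on homotopy classes -/

section Detection

open Limits

variable {A : Type u₁} [Category.{v₁} A] [ModelCategory A]

/-- A fibration between bifibrant objects that induces bijections on homotopy classes of maps from
cofibrant objects is a weak equivalence: it has a section by the covering homotopy theorem, and so
is a retract of a self-map homotopic to the identity. -/
lemma weakEquivalence_of_fibration_of_bijective_postcomp {X Y : A} [IsCofibrant X] [IsCofibrant Y]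
    (p : X ⟶ Y) [Fibration p]
    (h : ∀ (c : A) [IsCofibrant c],
      Function.Bijective (fun f : LeftHomotopyClass c X ↦ f.postcomp p)) :
    WeakEquivalence p := by
  obtain ⟨q₀, hq₀⟩ := (h Y).2 (.mk (𝟙 Y))
  obtain ⟨q₀, rfl⟩ := q₀.mk_surjective
  dsimp at hq₀
  rw [LeftHomotopyClass.mk_eq_mk_iff] at hq₀
  obtain ⟨P, _, ⟨H⟩⟩ := hq₀.exists_good_cylinder
  obtain ⟨q, H', hH'⟩ := H.covering_homotopy p q₀ rfl
  have hq : q ≫ p = 𝟙 Y := by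
    rw [← H'.h₁, Category.assoc, hH', H.h₁]
  have hpq : LeftHomotopyRel (p ≫ q) (𝟙 X) := by
    rw [← LeftHomotopyClass.mk_eq_mk_iff]
    apply (h X).1
    simp [hq]
  obtain ⟨_, ⟨K⟩⟩ := hpq
  have hK : WeakEquivalence (p ≫ q) := K.weakEquivalence_iff.2 inferInstance
  rw [weakEquivalence_iff] at hK ⊢
  refine MorphismProperty.of_retract (f := p) (g := p ≫ q) ?_ hK
  exact
    { i := Arrow.homMk (𝟙 X) q
      r := Arrow.homMk (𝟙 X) p (by simp [hq])
      retract := by ext <;> simp [hq] }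

/-- A map between fibrant objects that induces bijections on homotopy classes of maps from
cofibrant objects is a weak equivalence. -/
lemma weakEquivalence_of_bijective_postcomp {X Y : A} [IsFibrant X] [IsFibrant Y] (f : X ⟶ Y)
    (h : ∀ (c : A) [IsCofibrant c],
      Function.Bijective (fun g : LeftHomotopyClass c X ↦ g.postcomp f)) :
    WeakEquivalence f := by
  -- replace `f` by a fibration `b.p` between cofibrant replacements
  let dX := MorphismProperty.factorizationData (cofibrations A) (trivialFibrations A)
    (initial.to X)
  let dY := MorphismProperty.factorizationData (cofibrations A) (trivialFibrations A)
    (initial.to Y)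
  have : IsCofibrant dX.Z := by
    rw [isCofibrant_iff, Subsingleton.elim (initial.to dX.Z) dX.i]; infer_instance
  have : IsCofibrant dY.Z := by
    rw [isCofibrant_iff, Subsingleton.elim (initial.to dY.Z) dY.i]; infer_instance
  have : IsFibrant dX.Z := isFibrant_of_fibration dX.p
  have : IsFibrant dY.Z := isFibrant_of_fibration dY.p
  have sq : CommSq (initial.to dY.Z) (initial.to dX.Z) dY.p (dX.p ≫ f) := ⟨Subsingleton.elim _ _⟩
  let b := MorphismProperty.factorizationData (trivialCofibrations A) (fibrations A) sq.lift
  have fac : b.i ≫ b.p ≫ dY.p = dX.p ≫ f := by rw [b.fac_assoc, sq.fac_right]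
  have : IsFibrant b.Z := isFibrant_of_fibration b.p
  have : IsCofibrant b.Z := isCofibrant_of_cofibration b.i
  have : WeakEquivalence b.p := by
    refine weakEquivalence_of_fibration_of_bijective_postcomp b.p fun c _ ↦ ?_
    rw [← Function.Bijective.of_comp_iff'
        (LeftHomotopyClass.postcomp_bijective_of_weakEquivalence c dY.p),
      ← Function.Bijective.of_comp_iff _
        (LeftHomotopyClass.postcomp_bijective_of_weakEquivalence c b.i)]
    convert! (h c).comp (LeftHomotopyClass.postcomp_bijective_of_weakEquivalence c dX.p) using 1
    ext φ
    obtain ⟨φ, rfl⟩ := φ.mk_surjective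
    simp
  have : WeakEquivalence (dX.p ≫ f) := by rw [← fac]; infer_instance
  exact weakEquivalence_of_precomp dX.p f

/-- If a natural transformation `α : L₂ ⟶ L₁` between left Quillen functors is a weak equivalence
on cofibrant objects, then its conjugate `R₁ ⟶ R₂` is a weak equivalence on fibrant objects. -/
lemma weakEquivalence_conjugateEquiv_app {B : Type u₂} [Category.{v₂} B] [ModelCategory B]
    {L₁ L₂ : A ⥤ B} {R₁ R₂ : B ⥤ A} {adj₁ : L₁ ⊣ R₁} {adj₂ : L₂ ⊣ R₂}
    (h₁ : IsQuillenPair adj₁) (h₂ : IsQuillenPair adj₂) (α : L₂ ⟶ L₁)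
    (hα : ∀ (X : A) [IsCofibrant X], WeakEquivalence (α.app X)) (Y : B) [IsFibrant Y] :
    WeakEquivalence ((conjugateEquiv adj₁ adj₂ α).app Y) := by
  have := h₁.isFibrant Y
  have := h₂.isFibrant Y
  refine weakEquivalence_of_bijective_postcomp _ fun c _ ↦ ?_
  have := h₁.isCofibrant c
  have := h₂.isCofibrant c
  have := hα c
  have key (x : L₁.obj c ⟶ Y) : adj₁.homEquiv _ _ x ≫ (conjugateEquiv adj₁ adj₂ α).app Y =
      adj₂.homEquiv _ _ (α.app c ≫ x) := by
    apply (adj₂.homEquiv _ _).symm.injective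
    rw [Equiv.symm_apply_apply, Adjunction.homEquiv_counit, L₂.map_comp, Category.assoc,
      conjugateEquiv_counit, α.naturality_assoc, ← Adjunction.homEquiv_counit,
      Equiv.symm_apply_apply]
  have hbij := RightHomotopyClass.precomp_bijective_of_weakEquivalence Y (α.app c)
  constructor
  · intro x y hxy
    obtain ⟨x, rfl⟩ := x.mk_surjective
    obtain ⟨y, rfl⟩ := y.mk_surjective
    obtain ⟨x, rfl⟩ := (adj₁.homEquiv _ _).surjective x
    obtain ⟨y, rfl⟩ := (adj₁.homEquiv _ _).surjective y
    simp only [LeftHomotopyClass.postcomp_mk, key, LeftHomotopyClass.mk_eq_mk_iff] at hxy ⊢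
    rw [h₂.leftHomotopyRel_iff, leftHomotopyRel_iff_rightHomotopyRel] at hxy
    rw [h₁.leftHomotopyRel_iff, leftHomotopyRel_iff_rightHomotopyRel,
      ← RightHomotopyClass.mk_eq_mk_iff]
    apply hbij.1
    simpa [RightHomotopyClass.mk_eq_mk_iff] using hxy
  · intro z
    obtain ⟨z, rfl⟩ := z.mk_surjective
    obtain ⟨z, rfl⟩ := (adj₂.homEquiv _ _).surjective z
    obtain ⟨w, hw⟩ := hbij.2 (.mk z)
    obtain ⟨w, rfl⟩ := w.mk_surjective
    refine ⟨.mk (adj₁.homEquiv _ _ w), ?_⟩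
    simp only [RightHomotopyClass.precomp_mk, RightHomotopyClass.mk_eq_mk_iff] at hw
    simpa only [LeftHomotopyClass.postcomp_mk, key, LeftHomotopyClass.mk_eq_mk_iff,
      h₂.leftHomotopyRel_iff, leftHomotopyRel_iff_rightHomotopyRel] using hw

end Detection

/-! ### Mapping objects of module model categories -/

section PushoutProduct

open Limits

variable {M : Type u₁} [Category.{v₁} M] [ModelCategory M]
  {N : Type u₂} [Category.{v₂} N] [ModelCategory N]
  {P : Type u₃} [Category.{v₃} P] [ModelCategory P] {B : M ⥤ N ⥤ P}

/-- If `B(⊥, -)` is initial, then a map `B(X, j)` is the pushout-product of `⊥ ⟶ X` with `j`. -/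
noncomputable def initialPushoutObjObj (hB : ∀ c : N, IsInitial ((B.obj (⊥_ M)).obj c)) (X : M)
    {c c' : N} (j : c ⟶ c') : B.PushoutObjObj (initial.to X) j where
  pt := (B.obj X).obj c
  inl := 𝟙 _
  inr := (hB c').to _
  isPushout := by
    have : IsIso ((B.obj (⊥_ M)).map j) :=
      ⟨(hB c').to _, (hB c).hom_ext _ _, (hB c').hom_ext _ _⟩
    exact IsPushout.of_vert_isIso ⟨(hB c).hom_ext _ _⟩
  ι := (B.obj X).map j
  inl_ι := by simp
  inr_ι := (hB c').hom_ext _ _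

namespace PushoutProductAxiom

variable (h : PushoutProductAxiom B)
include h

lemma flip : PushoutProductAxiom B.flip where
  cofibration i j _ _ sq := h.cofibration j i sq.flip
  weakEquivalence_left i j _ _ _ sq := h.weakEquivalence_right j i sq.flip
  weakEquivalence_right i j _ _ _ sq := h.weakEquivalence_left j i sq.flip

/-- Under the pushout-product axiom, `B(X, -)` is left Quillen for `X` cofibrant. -/
lemma isQuillenPair (hB : ∀ c : N, IsInitial ((B.obj (⊥_ M)).obj c)) (X : M) [IsCofibrant X]
    {R : P ⥤ N} (adj : B.obj X ⊣ R) : IsQuillenPair adj where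
  cofibration j _ := h.cofibration _ j (initialPushoutObjObj hB X j)
  weakEquivalence j _ _ := h.weakEquivalence_right _ j (initialPushoutObjObj hB X j)

end PushoutProductAxiom

end PushoutProduct

section ModuleModel

open Limits ClosedModule

variable {C : Type u₁} [Category.{v₁} C] [MonoidalCategory C] [ModelCategory C]
  {M : Type u₂} [Category.{v₂} M] [ModelCategory M] [ClosedModule C M]
  [IsModuleModelCategory C M]

variable (C) in
/-- For `X` cofibrant, `X ⊙ᵣ -` is left Quillen. -/
lemma isQuillenPair_ehomAdj (X : M) [IsCofibrant X] :
    IsQuillenPair ((ehomAdj (C := C) (M := M)).adj X) :=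
  (IsModuleModelCategory.pushoutProduct (C := C) (M := M)).flip.isQuillenPair
    (fun c ↦
      have := ((cotensorAdj (C := C) (M := M)).adj c).leftAdjoint_preservesColimits
      initialIsInitial.isInitialObj ((curriedAction C M).obj c) _) X _

/-- For `c` cofibrant, `- ⊙ᵣ c` is left Quillen. -/
lemma isQuillenPair_cotensorAdj (c : C) [IsCofibrant c] :
    IsQuillenPair ((cotensorAdj (C := C) (M := M)).adj c) :=
  (IsModuleModelCategory.pushoutProduct (C := C) (M := M)).isQuillenPair
    (fun X ↦
      have := ((ehomAdj (C := C) (M := M)).adj X).leftAdjoint_preservesColimits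
      initialIsInitial.isInitialObj ((curriedAction C M).flip.obj X) _) c _

omit [ModelCategory C] [ModelCategory M] [IsModuleModelCategory C M] in
lemma conjugateEquiv_ehomAdj {X X' : M} (f : X ⟶ X') :
    conjugateEquiv ((ehomAdj (C := C) (M := M)).adj X') ((ehomAdj (C := C) (M := M)).adj X)
      ((curriedAction C M).flip.map f) = (ehom (C := C) (M := M)).map f.op := by
  ext Y
  apply mapObj_hom_ext
  exact (conjugateEquiv_counit ((ehomAdj (C := C) (M := M)).adj X')
    ((ehomAdj (C := C) (M := M)).adj X) ((curriedAction C M).flip.map f) Y).trans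
    (map_op_ev (C := C) f Y).symm

variable (C) in
/-- A weak equivalence between cofibrant objects induces a weak equivalence of mapping objects into
a fibrant object, as it does so on `- ⊙ᵣ c` for `c` cofibrant. -/
lemma weakEquivalence_ehom_map_app {X X' : M} [IsCofibrant X] [IsCofibrant X'] (f : X ⟶ X')
    [WeakEquivalence f] (Y : M) [IsFibrant Y] :
    WeakEquivalence (((ehom (C := C) (M := M)).map f.op).app Y) := by
  rw [← conjugateEquiv_ehomAdj]
  exact weakEquivalence_conjugateEquiv_app (isQuillenPair_ehomAdj C X')
    (isQuillenPair_ehomAdj C X) _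
    (fun c _ ↦ (isQuillenPair_cotensorAdj c).map_weakEquivalence_left f) Y

/-- The enrichment by mapping objects of a module model category is a model enrichment. -/
lemma isModelEnrichment_homEnrichment [SymmetricCategory C] :
    (homEnrichment C M).IsModelEnrichment where
  weakEquivalence_right X _ _ _ _ _ g _ :=
    (isQuillenPair_ehomAdj C X).map_weakEquivalence_right g
  weakEquivalence_left f _ Y _ := weakEquivalence_ehom_map_app C f Y

/-- The image of the mapping-object enrichment under a lax monoidal right Quillen functor is a
model enrichment. -/
lemma isModelEnrichment_homEnrichment_mapLax [SymmetricCategory C]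
    {E : Type u₃} [Category.{v₃} E] [MonoidalCategory E] [ModelCategory E]
    {F : E ⥤ C} {G : C ⥤ E} [G.LaxMonoidal] {adj : F ⊣ G} (h : IsQuillenPair adj) :
    ((homEnrichment C M).mapLax G).IsModelEnrichment where
  weakEquivalence_right X _ _ _ _ _ g _ :=
    (h.comp (isQuillenPair_ehomAdj C X)).map_weakEquivalence_right g
  weakEquivalence_left {X X'} _ _ f _ Y _ := by
    have := weakEquivalence_ehom_map_app C f Y
    have := (isQuillenPair_ehomAdj C X).isFibrant Y
    have := (isQuillenPair_ehomAdj C X').isFibrant Y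
    exact h.map_weakEquivalence_right (((ehom (C := C) (M := M)).map f.op).app Y)

/-- Model enrichments restrict along functors that preserve cofibrant objects, fibrant objects and
weak equivalences. -/
lemma Enrichment.IsModelEnrichment.comap
    {E : Type u₁} [Category.{v₁} E] [MonoidalCategory E] [ModelCategory E]
    {A : Type u₂} [Category.{v₂} A] [ModelCategory A] {σ : Enrichment E A}
    (hσ : σ.IsModelEnrichment) {N : Type u₃} [Category.{v₃} N] [ModelCategory N] (T : N ⥤ A)
    (hc : ∀ (X : N) [IsCofibrant X], IsCofibrant (T.obj X))
    (hf : ∀ (X : N) [IsFibrant X], IsFibrant (T.obj X))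
    (hT : ∀ {X Y : N} (f : X ⟶ Y) [WeakEquivalence f], WeakEquivalence (T.map f)) :
    (σ.comap T).IsModelEnrichment where
  weakEquivalence_right X _ _ _ _ _ g _ :=
    have := hc X
    have := hf
    have := hT g
    hσ.weakEquivalence_right (T.obj X) (T.map g)
  weakEquivalence_left f _ Y _ :=
    have := hc
    have := hf Y
    have := hT f
    hσ.weakEquivalence_left (T.map f) (T.obj Y)

end ModuleModel

section Replacement

variable {M : Type u₁} [Category.{v₁} M] [ModelCategory M]

lemma CofibrantReplacement.map_weakEquivalence (Q : CofibrantReplacement M) {X Y : M} (f : X ⟶ Y)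
    [WeakEquivalence f] : WeakEquivalence (Q.Q.map f) := by
  have := Q.weakEquivalence X
  have := Q.weakEquivalence Y
  exact weakEquivalence_of_postcomp_of_fac (fg := Q.π.app X ≫ f) (Q.π.naturality f)

lemma CofibrantReplacement.isFibrant (Q : CofibrantReplacement M) (X : M) [IsFibrant X] :
    IsFibrant (Q.Q.obj X) := by
  have := Q.fibration X
  have : IsFibrant ((𝟭 M).obj X) := ‹IsFibrant X›
  exact isFibrant_of_fibration (Q.π.app X)

lemma FibrantReplacement.map_weakEquivalence (T : FibrantReplacement M) {X Y : M} (f : X ⟶ Y)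
    [WeakEquivalence f] : WeakEquivalence (T.Fib.map f) := by
  have := T.weakEquivalence X
  have := T.weakEquivalence Y
  have : WeakEquivalence ((𝟭 M).map f) := ‹WeakEquivalence f›
  exact weakEquivalence_of_precomp_of_fac (fg := (𝟭 M).map f ≫ T.ι.app Y) (T.ι.naturality f).symm

lemma FibrantReplacement.isCofibrant (T : FibrantReplacement M) (X : M) [IsCofibrant X] :
    IsCofibrant (T.Fib.obj X) := by
  have := T.cofibration X
  have : IsCofibrant ((𝟭 M).obj X) := ‹IsCofibrant X›
  exact isCofibrant_of_cofibration (T.ι.app X)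

end Replacement

/-! ### Bimodules from enriched functors -/

namespace Enrichment

variable {C : Type u₁} [Category.{v₁} C] [MonoidalCategory C]
  {M : Type u₂} [Category.{v₂} M] {N : Type u₃} [Category.{v₃} N]

section

variable (σ : Enrichment C M)

lemma whiskerRight_comp_comp {U : C} {W X Y Z : M} (f : U ⟶ σ.Hom Y Z) :
    (f ▷ σ.Hom X Y ≫ σ.comp X Y Z) ▷ σ.Hom W X ≫ σ.comp W X Z =
      (α_ _ _ _).hom ≫ U ◁ σ.comp W X Y ≫ f ▷ σ.Hom W Y ≫ σ.comp W Y Z := by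
  rw [comp_whiskerRight_assoc, σ.assoc, associator_naturality_left_assoc, whisker_exchange_assoc]

lemma tensorHom_comp_comp {U V : C} {W X Y Z : M} (f : U ⟶ σ.Hom Y Z) (g : V ⟶ σ.Hom X Y) :
    ((f ⊗ₘ g) ≫ σ.comp X Y Z) ▷ σ.Hom W X ≫ σ.comp W X Z =
      (α_ _ _ _).hom ≫ U ◁ (g ▷ σ.Hom W X ≫ σ.comp W X Y) ≫ f ▷ σ.Hom W Y ≫ σ.comp W Y Z := by
  rw [MonoidalCategory.tensorHom_def', Category.assoc, comp_whiskerRight_assoc,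
    whiskerRight_comp_comp, MonoidalCategory.whiskerLeft_comp_assoc,
    associator_naturality_middle_assoc]

lemma unit_map_comp {U : C} {X' X Y : M} (p : X' ⟶ X) (f : U ⟶ σ.Hom X Y) :
    (ρ_ U).inv ≫ U ◁ (σ.unit X' ≫ (σ.hom.obj (op X')).map p) ≫ f ▷ σ.Hom X' X ≫ σ.comp X' X Y =
      f ≫ (σ.hom.map p.op).app Y := by
  have h₁ := σ.comp_natural_left p X Y
  have h₂ := σ.comp_unit X Y
  rw [Iso.inv_comp_eq, σ.unit_natural, whisker_exchange_assoc,
    MonoidalCategory.whiskerLeft_comp_assoc, ← h₁, reassoc_of% h₂, rightUnitor_naturality_assoc]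

lemma comp_unit_map {X Y Y' : M} (q : Y ⟶ Y') :
    (λ_ (σ.Hom X Y)).inv ≫ (σ.unit Y ≫ (σ.hom.obj (op Y)).map q) ▷ σ.Hom X Y ≫ σ.comp X Y Y' =
      (σ.hom.obj (op X)).map q := by
  have h₁ := σ.comp_natural_right X Y q
  have h₂ := σ.unit_comp X Y
  rw [Iso.inv_comp_eq, comp_whiskerRight_assoc, ← h₁, reassoc_of% h₂]

end

/-- The structure of an enriched functor on a functor `T : N ⥤ M`: maps `τ(X, Y) ⟶ σ(T X, T Y)`
compatible with composition and units. Only naturality in the second variable is required, which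
is all that the left action of `τ` on `σ(-, T -)` needs. -/
structure FunctorStruct (τ : Enrichment C N) (σ : Enrichment C M) (T : N ⥤ M) where
  /-- the maps on mapping objects -/
  app (X Y : N) : τ.Hom X Y ⟶ σ.Hom (T.obj X) (T.obj Y)
  naturality_right (X : N) {Y Y' : N} (g : Y ⟶ Y') :
    (τ.hom.obj (op X)).map g ≫ app X Y' = app X Y ≫ (σ.hom.obj (op (T.obj X))).map (T.map g)
  app_comp (X Y Z : N) :
    τ.comp X Y Z ≫ app X Z = (app Y Z ⊗ₘ app X Y) ≫ σ.comp (T.obj X) (T.obj Y) (T.obj Z)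
  app_unit (X : N) : τ.unit X ≫ app X X = σ.unit (T.obj X)

/-- The functor `T`, as an enriched functor from `σ(T -, T -)` to `σ`. -/
def FunctorStruct.ofComap (σ : Enrichment C M) (T : N ⥤ M) :
    FunctorStruct (σ.comap T) σ T where
  app X Y := 𝟙 (σ.Hom (T.obj X) (T.obj Y))
  naturality_right X _ _ g :=
    (Category.comp_id ((σ.hom.obj (op (T.obj X))).map (T.map g))).trans (Category.id_comp _).symm
  app_comp X Y Z := by
    have h : (𝟙 _ ⊗ₘ 𝟙 _) ≫ σ.comp (T.obj X) (T.obj Y) (T.obj Z) =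
        σ.comp (T.obj X) (T.obj Y) (T.obj Z) := by
      rw [id_tensorHom_id, Category.id_comp]
    exact (Category.comp_id (σ.comp (T.obj X) (T.obj Y) (T.obj Z))).trans h.symm
  app_unit X := Category.comp_id (σ.unit (T.obj X))

/-- Restriction of an enriched functor along a functor. -/
def FunctorStruct.comap {τ : Enrichment C N} {σ : Enrichment C M} {T : N ⥤ M}
    (Φ : FunctorStruct τ σ T) {N' : Type u₄} [Category.{v₄} N'] (S : N' ⥤ N) :
    FunctorStruct (τ.comap S) σ (S ⋙ T) where
  app X Y := Φ.app (S.obj X) (S.obj Y)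
  naturality_right _ _ _ g := Φ.naturality_right _ (S.map g)
  app_comp _ _ _ := Φ.app_comp _ _ _
  app_unit _ := Φ.app_unit _

/-- The pointed bimodule `B(a, b) = σ(S a, T b)` attached to a natural transformation `π : S ⟶ T`:
`σ(S -, S -)` acts on the right by composition, and `τ` acts on the left through an enriched
functor structure on `T`; the points are given by `π`. -/
def bimodule (σ : Enrichment C M) {S T : N ⥤ M} (π : S ⟶ T) {τ : Enrichment C N}
    (Φ : FunctorStruct τ σ T) : PointedBimodule τ (σ.comap S) where
  obj := S.op ⋙ σ.hom ⋙ (Functor.whiskeringLeft N M C).obj T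
  left a b c := Φ.app b c ▷ _ ≫ σ.comp (S.obj a) (T.obj b) (T.obj c)
  right a b c := σ.comp (S.obj a) (S.obj b) (T.obj c)
  left_natural_left f b c := by
    have := σ.comp_natural_left (S.map f) (T.obj b) (T.obj c)
    dsimp
    rw [Category.assoc, this, whisker_exchange_assoc]
  left_natural_right a b c c' g := by
    have h₁ := σ.comp_natural_right (S.obj a) (T.obj b) (T.map g)
    have h₂ := Φ.naturality_right b g
    dsimp
    rw [Category.assoc, h₁, ← comp_whiskerRight_assoc, ← comp_whiskerRight_assoc, h₂]
  right_natural_left f _ _ := σ.comp_natural_left (S.map f) _ _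
  right_natural_right _ _ _ _ g := σ.comp_natural_right _ _ (T.map g)
  left_assoc a b c d := by
    dsimp
    rw [← comp_whiskerRight_assoc, Φ.app_comp, tensorHom_comp_comp]
  left_unit a b := by
    dsimp
    rw [← comp_whiskerRight_assoc, Φ.app_unit, σ.unit_comp]
  right_assoc _ _ _ _ := σ.assoc _ _ _ _
  right_unit _ _ := σ.comp_unit _ _
  left_right a b c d := σ.whiskerRight_comp_comp (Φ.app c d)
  point a := σ.unit (S.obj a) ≫ (σ.hom.obj (op (S.obj a))).map (π.app a)
  point_natural {a b} f := by
    have h := σ.unit_natural (S.map f)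
    dsimp
    rw [Category.assoc, Category.assoc, ← Functor.map_comp, ← π.naturality, Functor.map_comp,
      reassoc_of% h, NatTrans.naturality]

variable (σ : Enrichment C M) {S T : N ⥤ M} (π : S ⟶ T) {τ : Enrichment C N}
  (Φ : FunctorStruct τ σ T)

lemma bimodule_left_point (a b : N) :
    (ρ_ _).inv ≫ τ.Hom a b ◁ (σ.bimodule π Φ).point a ≫ (σ.bimodule π Φ).left a a b =
      Φ.app a b ≫ (σ.hom.map (π.app a).op).app (T.obj b) :=
  σ.unit_map_comp (π.app a) (Φ.app a b)

lemma bimodule_right_point (a b : N) :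
    (λ_ _).inv ≫ (σ.bimodule π Φ).point b ▷ (σ.comap S).Hom a b ≫
        (σ.bimodule π Φ).right a b b =
      (σ.hom.obj (op (S.obj a))).map (π.app b) :=
  σ.comp_unit_map (π.app b)

end Enrichment

section

variable {C : Type u₁} [Category.{v₁} C] [MonoidalCategory C] [ModelCategory C]
  {M : Type u₂} [Category.{v₂} M] {N : Type u₃} [Category.{v₃} N] [ModelCategory N]

lemma QuasiEquivalent.symm {σ τ : Enrichment C N} (h : QuasiEquivalent σ τ) :
    QuasiEquivalent τ σ :=
  let ⟨hσ, hτ, H⟩ := h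
  ⟨hτ, hσ, H.symm⟩

lemma QuasiEquivalent.trans {σ τ υ : Enrichment C N} (h : QuasiEquivalent σ τ)
    (h' : QuasiEquivalent τ υ) : QuasiEquivalent σ υ :=
  let ⟨hσ, _, H⟩ := h
  let ⟨_, hυ, H'⟩ := h'
  ⟨hσ, hυ, H.trans _ _ _ H'⟩

/-- The bimodule `σ(S -, T -)` is a quasi-equivalence as soon as the composites
`τ(a, b) ⟶ σ(T a, T b) ⟶ σ(S a, T b)` and the maps `σ(S a, S b) ⟶ σ(S a, T b)` are weak
equivalences for `a` cofibrant and `b` fibrant. -/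
lemma Enrichment.FunctorStruct.quasiEquivalent_comap {σ : Enrichment C M} {τ : Enrichment C N}
    {S T : N ⥤ M} (Φ : FunctorStruct τ σ T) (π : S ⟶ T) (hτ : τ.IsModelEnrichment)
    (hS : (σ.comap S).IsModelEnrichment)
    (hleft : ∀ (a b : N) [IsCofibrant a] [IsFibrant b],
      WeakEquivalence (Φ.app a b ≫ (σ.hom.map (π.app a).op).app (T.obj b)))
    (hright : ∀ (a b : N) [IsCofibrant a] [IsFibrant b],
      WeakEquivalence ((σ.hom.obj (op (S.obj a))).map (π.app b))) :
    QuasiEquivalent τ (σ.comap S) := by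
  refine ⟨hτ, hS, .rel _ _ ⟨σ.bimodule π Φ, ⟨fun a b _ _ ↦ ?_, fun a b _ _ ↦ ?_⟩⟩⟩
  · rw [bimodule_left_point]
    exact hleft a b
  · rw [bimodule_right_point]
    exact hright a b

/-- Restricting a model enrichment along a fibrant-replacement functor gives a quasi-equivalent
model enrichment. -/
lemma quasiEquivalent_comap_fibrantReplacement {σ : Enrichment C N} (hσ : σ.IsModelEnrichment)
    (T : FibrantReplacement N) : QuasiEquivalent (σ.comap T.Fib) σ := by
  have hT : (σ.comap T.Fib).IsModelEnrichment :=
    hσ.comap T.Fib (fun X _ ↦ T.isCofibrant X) (fun X _ ↦ T.isFibrant X)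
      (fun f _ ↦ T.map_weakEquivalence f)
  refine (Enrichment.FunctorStruct.ofComap σ T.Fib).quasiEquivalent_comap T.ι hT hσ
    (fun a b _ _ ↦ ?_) (fun a b _ _ ↦ ?_)
  · have := T.isCofibrant a
    have := T.isFibrant b
    have := T.weakEquivalence a
    have : IsCofibrant ((𝟭 N).obj a) := ‹IsCofibrant a›
    have := hσ.weakEquivalence_left (T.ι.app a) (T.Fib.obj b)
    exact (Category.id_comp ((σ.hom.map (T.ι.app a).op).app (T.Fib.obj b))).symm ▸ this
  · have := T.isFibrant b
    have := T.weakEquivalence b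
    have : IsFibrant ((𝟭 N).obj b) := ‹IsFibrant b›
    exact hσ.weakEquivalence_right a (T.ι.app b)

end

/-! ### The enriched right adjoint of an adjoint module -/

section

open Functor.LaxMonoidal Functor.OplaxMonoidal

/-- The adjoint of the lax structure map of `G` is the oplax structure map of `F`. -/
lemma homEquiv_symm_μ {C : Type u₁} [Category.{v₁} C] [MonoidalCategory C]
    {D : Type u₂} [Category.{v₂} D] [MonoidalCategory D] {F : C ⥤ D} {G : D ⥤ C} (adj : F ⊣ G)
    [G.LaxMonoidal] (X Y : D) :
    letI := adj.leftAdjointOplaxMonoidal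
    (adj.homEquiv _ _).symm (μ G X Y) =
      δ F _ _ ≫ ((adj.homEquiv _ _).symm (𝟙 (G.obj X)) ⊗ₘ
        (adj.homEquiv _ _).symm (𝟙 (G.obj Y))) := by
  let := adj.leftAdjointOplaxMonoidal
  simp only [Adjunction.homEquiv_counit, F.map_id, Category.id_comp]
  exact adj.map_μ_comp_counit_app_tensor X Y

end

namespace AdjointModule

open ClosedModule

variable {C : Type u₁} [Category.{v₁} C] [MonoidalCategory C]
  {D : Type u₂} [Category.{v₂} D] [MonoidalCategory D]
  {M : Type u₃} [Category.{v₃} M] [ClosedModule C M]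
  {N : Type u₄} [Category.{v₄} N] [ClosedModule D N]
  {F : C ⥤ D} {G : D ⥤ C} {adj : F ⊣ G} [G.LaxMonoidal]
  {L : M ⥤ N} {R : N ⥤ M} {adj' : L ⊣ R} (A : AdjointModule adj adj')

/-- Maps into `Hom_C(X, R Y)` are determined by their adjoints `L (X ⊙ᵣ c) ⟶ Y`. -/
lemma mapObj_hom_ext (adj' : L ⊣ R) {X : M} {Y : N} {c : C} {f g : c ⟶ mapObj C X (R.obj Y)}
    (h : (adj'.homEquiv _ _).symm (X ⊴ᵣ f ≫ ev C X (R.obj Y)) =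
      (adj'.homEquiv _ _).symm (X ⊴ᵣ g ≫ ev C X (R.obj Y))) : f = g :=
  EnrichedModel.mapObj_hom_ext ((adj'.homEquiv _ _).symm.injective h)

/-- The transformation `L (X ⊙ᵣ c) ⟶ L X ⊙ᵣ F c` as a natural transformation in `c`. -/
@[simps]
def γNatTrans (X : M) :
    (curriedAction C M).flip.obj X ⋙ L ⟶ F ⋙ (curriedAction D N).flip.obj (L.obj X) where
  app c := A.γ X c
  naturality _ _ g := A.γ_natural_right X g

/-- The map `G Hom_D(L X, Y) ⟶ Hom_C(X, R Y)` conjugate to `γ : L (X ⊙ᵣ c) ⟶ L X ⊙ᵣ F c`. -/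
def conj (X : M) (Y : N) : G.obj (mapObj D (L.obj X) Y) ⟶ mapObj C X (R.obj Y) :=
  (conjugateEquiv (adj.comp ((ehomAdj (C := D) (M := N)).adj (L.obj X)))
    (((ehomAdj (C := C) (M := M)).adj X).comp adj') (A.γNatTrans X)).app Y

lemma conj_ev (X : M) (Y : N) {c : C} (z : c ⟶ G.obj (mapObj D (L.obj X) Y)) :
    (adj'.homEquiv _ _).symm (X ⊴ᵣ (z ≫ A.conj X Y) ≫ ev C X (R.obj Y)) =
      A.γ X c ≫ L.obj X ⊴ᵣ (adj.homEquiv _ _).symm z ≫ ev D (L.obj X) Y := by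
  have h := conjugateEquiv_counit (adj.comp ((ehomAdj (C := D) (M := N)).adj (L.obj X)))
    (((ehomAdj (C := C) (M := M)).adj X).comp adj') (A.γNatTrans X) Y
  rw [Adjunction.comp_counit_app, Adjunction.comp_counit_app] at h
  have h' : L.map (X ⊴ᵣ A.conj X Y) ≫ L.map (ev C X (R.obj Y)) ≫ adj'.counit.app Y =
      A.γ X _ ≫ L.obj X ⊴ᵣ adj.counit.app (mapObj D (L.obj X) Y) ≫ ev D (L.obj X) Y := h
  rw [actionHomRight_comp, Category.assoc, Adjunction.homEquiv_naturality_left_symm,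
    Adjunction.homEquiv_counit, L.map_comp, Category.assoc, h',
    reassoc_of% A.γ_natural_right, ← actionHomRight_comp_assoc, Adjunction.homEquiv_counit]

/-- The adjoint of the composite `c ⟶ G Hom_D(Y, Z) ⟶ G Hom_D(L X, Z) ⟶ Hom_C(X, R Z)` induced by
maps `h : L X ⟶ Y` and `z`. -/
lemma map_conj_ev {X : M} {Y : N} (h : L.obj X ⟶ Y) (Z : N) {c : C}
    (z : c ⟶ G.obj (mapObj D Y Z)) :
    (adj'.homEquiv _ _).symm
        (X ⊴ᵣ (z ≫ G.map (((ehom (C := D) (M := N)).map h.op).app Z) ≫ A.conj X Z) ≫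
          ev C X (R.obj Z)) =
      A.γ X c ≫ h ⊵ᵣ F.obj c ≫ Y ⊴ᵣ (adj.homEquiv _ _).symm z ≫ ev D Y Z := by
  rw [← Category.assoc z, conj_ev, Adjunction.homEquiv_naturality_right_symm,
    actionHomRight_comp, Category.assoc, map_op_ev, action_exchange_assoc]

/-- The map `G Hom_D(Y, Z) ⟶ Hom_C(R Y, R Z)` through which `R` is an enriched functor. -/
def mapRight (Y Z : N) : G.obj (mapObj D Y Z) ⟶ mapObj C (R.obj Y) (R.obj Z) :=
  G.map (((ehom (C := D) (M := N)).map ((adj'.homEquiv (R.obj Y) Y).symm (𝟙 _)).op).app Z) ≫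
    A.conj (R.obj Y) Z

/-- The adjoint of the composite `X ⊙ᵣ c ⟶ R Y ⊙ᵣ Hom_C(R Y, R Z) ⟶ R Z` induced by maps
`p : X ⟶ R Y` and `z : c ⟶ G Hom_D(Y, Z)`. -/
lemma mapRight_ev {X : M} {Y : N} (p : X ⟶ R.obj Y) (Z : N) {c : C}
    (z : c ⟶ G.obj (mapObj D Y Z)) :
    (adj'.homEquiv _ _).symm
        (p ⊵ᵣ c ≫ R.obj Y ⊴ᵣ (z ≫ A.mapRight Y Z) ≫ ev C (R.obj Y) (R.obj Z)) =
      A.γ X c ≫ (adj'.homEquiv _ _).symm p ⊵ᵣ F.obj c ≫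
        Y ⊴ᵣ (adj.homEquiv _ _).symm z ≫ ev D Y Z := by
  rw [Adjunction.homEquiv_naturality_left_symm, mapRight, map_conj_ev,
    reassoc_of% A.γ_natural_left, ← comp_actionHomLeft_assoc,
    ← Adjunction.homEquiv_naturality_left_symm, Category.comp_id]

/-- After restriction along `p : X ⟶ R Y`, the enriched functor `R` becomes `conj` restricted along
the adjoint `L X ⟶ Y` of `p`. -/
lemma mapRight_map {X : M} {Y : N} (p : X ⟶ R.obj Y) (Z : N) :
    A.mapRight Y Z ≫ ((ehom (C := C) (M := M)).map p.op).app (R.obj Z) =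
      G.map (((ehom (C := D) (M := N)).map ((adj'.homEquiv _ _).symm p).op).app Z) ≫
        A.conj X Z := by
  apply mapObj_hom_ext adj'
  have h := A.map_conj_ev ((adj'.homEquiv _ _).symm p) Z (𝟙 _)
  have h' := A.mapRight_ev p Z (𝟙 _)
  rw [Category.id_comp] at h h'
  rw [h, ← h', actionHomRight_comp, Category.assoc, map_op_ev, action_exchange_assoc]

lemma mapRight_natural_right (X : N) {Y Y' : N} (g : Y ⟶ Y') :
    G.map (((ehom (C := D) (M := N)).obj (op X)).map g) ≫ A.mapRight X Y' =
      A.mapRight X Y ≫ ((ehom (C := C) (M := M)).obj (op (R.obj X))).map (R.map g) := by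
  apply mapObj_hom_ext adj'
  have h := A.mapRight_ev (𝟙 _) Y' (G.map (((ehom (C := D) (M := N)).obj (op X)).map g))
  have h' := A.mapRight_ev (𝟙 (R.obj X)) Y (𝟙 _)
  have e := adj.homEquiv_naturality_right_symm (𝟙 _) (((ehom (C := D) (M := N)).obj (op X)).map g)
  rw [Category.id_comp] at e
  rw [id_actionHomLeft, Category.id_comp] at h h'
  rw [Category.id_comp] at h'
  rw [h, e, actionHomRight_comp, Category.assoc, map_ev,
    actionHomRight_comp, Category.assoc, map_ev, ← Category.assoc (_ ⊴ᵣ _) (ev _ _ _) (R.map g),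
    Adjunction.homEquiv_naturality_right_symm, h']
  simp only [Category.assoc]

open Functor.LaxMonoidal Functor.OplaxMonoidal in
lemma ε_mapRight (X : N) :
    (ε G ≫ G.map (curry (C := D) (ρᵣ X).hom)) ≫ A.mapRight X X =
      curry (C := C) (ρᵣ (R.obj X)).hom := by
  let := adj.leftAdjointOplaxMonoidal
  apply mapObj_hom_ext adj'
  have h := A.γ_unit (R.obj X)
  have h' := A.mapRight_ev (𝟙 _) X (ε G ≫ G.map (curry (C := D) (ρᵣ X).hom))
  rw [id_actionHomLeft, Category.id_comp] at h'
  rw [h', Adjunction.homEquiv_naturality_right_symm, actionHomRight_comp, Category.assoc,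
    curry_ev, curry_ev, ← action_exchange_assoc, ← actionUnitIso_hom_naturality]
  rw [← cancel_epi (L.map (ρᵣ[C] (R.obj X)).inv), ← adj.leftAdjointOplaxMonoidal_η,
    reassoc_of% h, Iso.inv_hom_id_assoc, ← Adjunction.homEquiv_naturality_left_symm,
    Iso.inv_hom_id]

open Functor.LaxMonoidal in
lemma μ_mapRight (X Y Z : N) :
    (μ G _ _ ≫ G.map (compDiag (C := D) X Y Z)) ≫ A.mapRight X Z =
      (A.mapRight X Y ⊗ₘ A.mapRight Y Z) ≫ compDiag (R.obj X) (R.obj Y) (R.obj Z) := by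
  let := adj.leftAdjointOplaxMonoidal
  apply mapObj_hom_ext adj'
  set s := (adj.homEquiv _ _).symm (𝟙 (G.obj (mapObj D X Y)))
  set t := (adj.homEquiv _ _).symm (𝟙 (G.obj (mapObj D Y Z)))
  set u := R.obj X ⊴ᵣ A.mapRight X Y ≫ ev C (R.obj X) (R.obj Y) with hu
  have hγ := A.γ_assoc (R.obj X) (G.obj (mapObj D X Y)) (G.obj (mapObj D Y Z))
  have hα := actionAssocIso_hom_naturality (𝟙 X) s t
  have hα' := actionAssocIso_hom_naturality (𝟙 (R.obj X)) (A.mapRight X Y) (A.mapRight Y Z)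
  simp only [id_actionHom] at hα hα'
  have h := A.mapRight_ev (𝟙 _) Z (μ G _ _ ≫ G.map (compDiag (C := D) X Y Z))
  have hXY := A.mapRight_ev (𝟙 (R.obj X)) Y (𝟙 _)
  have hYZ := A.mapRight_ev u Z (𝟙 _)
  rw [id_actionHomLeft, Category.id_comp] at h hXY
  rw [Category.id_comp] at hXY hYZ
  rw [h, Adjunction.homEquiv_naturality_right_symm, homEquiv_symm_μ]
  have hr : R.obj X ⊴ᵣ ((A.mapRight X Y ⊗ₘ A.mapRight Y Z) ≫
      compDiag (R.obj X) (R.obj Y) (R.obj Z)) ≫ ev C (R.obj X) (R.obj Z) =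
      (αᵣ _ _ _).hom ≫ u ⊵ᵣ G.obj (mapObj D Y Z) ≫
        R.obj Y ⊴ᵣ A.mapRight Y Z ≫ ev C (R.obj Y) (R.obj Z) := by
    rw [actionHomRight_comp, Category.assoc, compDiag_ev, reassoc_of% hα', actionHom_def,
      Category.assoc, action_exchange_assoc, hu, comp_actionHomLeft_assoc]
  rw [hr, Adjunction.homEquiv_naturality_left_symm, hYZ, hu, hXY,
    actionHomRight_comp, actionHomRight_comp, Category.assoc, Category.assoc, compDiag_ev,
    reassoc_of% hα, ← action_exchange_assoc, actionHomLeft_tensor_assoc, Iso.inv_hom_id_assoc,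
    ← reassoc_of% hγ, actionHom_def, Category.assoc, action_exchange_assoc]
  simp only [comp_actionHomLeft, Category.assoc, s, t]

end AdjointModule

section

open ClosedModule

variable {C : Type u₁} [Category.{v₁} C] [MonoidalCategory C] [SymmetricCategory C]
  {D : Type u₂} [Category.{v₂} D] [MonoidalCategory D] [SymmetricCategory D]
  {M : Type u₃} [Category.{v₃} M] [ClosedModule C M]
  {N : Type u₄} [Category.{v₄} N] [ClosedModule D N]
  {F : C ⥤ D} {G : D ⥤ C} {adj : F ⊣ G} [G.LaxBraided]
  {L : M ⥤ N} {R : N ⥤ M} {adj' : L ⊣ R} (A : AdjointModule adj adj')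

open Functor.LaxMonoidal in
lemma AdjointModule.μ_braiding_mapRight (X Y Z : N) :
    (μ G _ _ ≫ G.map ((β_ (mapObj D Y Z) (mapObj D X Y)).hom ≫ compDiag X Y Z)) ≫
        A.mapRight X Z =
      (A.mapRight Y Z ⊗ₘ A.mapRight X Y) ≫
        (β_ _ _).hom ≫ compDiag (R.obj X) (R.obj Y) (R.obj Z) := by
  rw [G.map_comp, Functor.LaxBraided.braided_assoc, Category.assoc, A.μ_mapRight,
    BraidedCategory.braiding_naturality_assoc]

/-- For an adjoint module, `R` is an enriched functor from `G Hom_D` to `Hom_C`. -/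
def AdjointModule.functorStruct :
    Enrichment.FunctorStruct ((homEnrichment D N).mapLax G) (homEnrichment C M) R where
  app := A.mapRight
  naturality_right X _ _ g := A.mapRight_natural_right X g
  app_comp X Y Z := A.μ_braiding_mapRight X Y Z
  app_unit X := A.ε_mapRight X

end

/-! ### Comparison for a Quillen adjoint module over a Quillen equivalence -/

section

open ClosedModule

variable {C : Type u₁} [Category.{v₁} C] [MonoidalCategory C] [ModelCategory C]
  {D : Type u₂} [Category.{v₂} D] [MonoidalCategory D] [ModelCategory D]
  {M : Type u₃} [Category.{v₃} M] [ModelCategory M] [ClosedModule C M]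
  [IsModuleModelCategory C M]
  {N : Type u₄} [Category.{v₄} N] [ModelCategory N] [ClosedModule D N]
  [IsModuleModelCategory D N]
  {F : C ⥤ D} {G : D ⥤ C} {adj : F ⊣ G} [G.LaxMonoidal]
  {L : M ⥤ N} {R : N ⥤ M} {adj' : L ⊣ R}

/-- Let `γ : L (X ⊙ᵣ c) ⟶ L X ⊙ᵣ F c` be a weak equivalence for `X` and `c` cofibrant, and let
`p : X ⟶ R Y` be adjoint to a weak equivalence `L X ⟶ Y`, with `X` and `Y` cofibrant. Then
`G Hom_D(Y, Z) ⟶ Hom_C(R Y, R Z) ⟶ Hom_C(X, R Z)` is a weak equivalence for `Z` fibrant. -/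
lemma AdjointModule.weakEquivalence_mapRight_map (A : AdjointModule adj adj')
    (hA : ∀ (X : M) (c : C) [IsCofibrant X] [IsCofibrant c], WeakEquivalence (A.γ X c))
    (h : IsQuillenPair adj) (h' : IsQuillenPair adj') {X : M} [IsCofibrant X]
    {Y : N} [IsCofibrant Y] (p : X ⟶ R.obj Y) (hp : WeakEquivalence ((adj'.homEquiv _ _).symm p))
    (Z : N) [IsFibrant Z] :
    WeakEquivalence
      (A.mapRight Y Z ≫ ((ehom (C := C) (M := M)).map p.op).app (R.obj Z)) := by
  have := h'.isCofibrant X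
  have hconj : WeakEquivalence (A.conj X Z) :=
    weakEquivalence_conjugateEquiv_app (h.comp (isQuillenPair_ehomAdj D (L.obj X)))
      ((isQuillenPair_ehomAdj C X).comp h') _ (fun c _ ↦ hA X c) Z
  have := weakEquivalence_ehom_map_app D ((adj'.homEquiv _ _).symm p) Z
  have := (isQuillenPair_ehomAdj D (L.obj X)).isFibrant Z
  have := (isQuillenPair_ehomAdj D Y).isFibrant Z
  have := h.map_weakEquivalence_right
    (((ehom (C := D) (M := N)).map ((adj'.homEquiv _ _).symm p).op).app Z)
  rw [mapRight_map]
  infer_instance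

/-- `Hom_C(X, Q Y) ⟶ Hom_C(X, Y)` is a weak equivalence for `X` cofibrant. -/
lemma CofibrantReplacement.weakEquivalence_ehom_map (Q : CofibrantReplacement M) (X Y : M)
    [IsCofibrant X] :
    WeakEquivalence (((ehom (C := C) (M := M)).obj (op X)).map (Q.π.app Y)) :=
  have := Q.fibration Y
  have := Q.weakEquivalence Y
  (isQuillenPair_ehomAdj C X).map_trivialFibration (Q.π.app Y)

lemma IsQuillenEquivalence.homEquiv_symm_π (h : IsQuillenEquivalence adj')
    (Q : CofibrantReplacement M) (Y : N) [IsFibrant Y] :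
    WeakEquivalence ((adj'.homEquiv _ _).symm (Q.π.app (R.obj Y))) := by
  have := Q.isCofibrant (R.obj Y)
  rw [h.weakEquivalence_iff, Equiv.apply_symm_apply]
  exact Q.weakEquivalence _

/-- If `R` preserves all weak equivalences, then the derived counit `L Q R Y ⟶ Y` is a weak
equivalence for every `Y`, fibrant or not. -/
lemma IsQuillenEquivalence.homEquiv_symm_π_of_map_weakEquivalence (h : IsQuillenEquivalence adj')
    (Q : CofibrantReplacement M) (T : FibrantReplacement N)
    (hR : ∀ {X Y : N} (f : X ⟶ Y), WeakEquivalence f → WeakEquivalence (R.map f)) (Y : N) :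
    WeakEquivalence ((adj'.homEquiv _ _).symm (Q.π.app (R.obj Y))) := by
  have := T.isFibrant Y
  have := T.weakEquivalence Y
  have := h.homEquiv_symm_π Q (T.Fib.obj Y)
  have := Q.isCofibrant (R.obj Y)
  have := Q.isCofibrant (R.obj (T.Fib.obj Y))
  let i : Y ⟶ T.Fib.obj Y := T.ι.app Y
  have : WeakEquivalence i := T.weakEquivalence Y
  have := hR i inferInstance
  have := Q.map_weakEquivalence (R.map i)
  have := h.toIsQuillenPair.map_weakEquivalence_left (Q.Q.map (R.map i))
  have e : L.map (Q.Q.map (R.map i)) ≫ (adj'.homEquiv _ _).symm (Q.π.app (R.obj (T.Fib.obj Y))) =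
      (adj'.homEquiv _ _).symm (Q.π.app (R.obj Y)) ≫ i := by
    rw [← Adjunction.homEquiv_naturality_left_symm, ← Adjunction.homEquiv_naturality_right_symm]
    exact congrArg _ (Q.π.naturality (R.map i))
  exact weakEquivalence_of_postcomp_of_fac e.symm

end

end EnrichedModel

theorem theorem3
    {C : Type u₁} [Category.{v₁} C] [MonoidalCategory C] [SymmetricCategory C] [MonoidalClosed C]
    [ModelCategory C] [SymmetricMonoidalModelCategory C]
    {D : Type u₂} [Category.{v₂} D] [MonoidalCategory D] [SymmetricCategory D] [MonoidalClosed D]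
    [ModelCategory D] [SymmetricMonoidalModelCategory D]
    {M : Type u₃} [Category.{v₃} M] [ModelCategory M] [ClosedModule C M]
    [IsModuleModelCategory C M]
    {N : Type u₄} [Category.{v₄} N] [ModelCategory N] [ClosedModule D N]
    [IsModuleModelCategory D N]
    {F : C ⥤ D} {G : D ⥤ C} (adj : F ⊣ G) [G.LaxBraided]
    {L : M ⥤ N} {R : N ⥤ M} (adj' : L ⊣ R)
    (hmod : IsQuillenAdjointModule adj adj') (hequiv : IsQuillenEquivalence adj')
    (Q : CofibrantReplacement M) (Fib : FibrantReplacement N) :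
    QuasiEquivalent ((homEnrichment C M).pushforward R Q Fib) ((homEnrichment D N).mapLax G) ∧
      ((∀ {X Y : N} (f : X ⟶ Y), WeakEquivalence f → WeakEquivalence (R.map f)) →
        QuasiEquivalent ((homEnrichment D N).mapLax G) ((homEnrichment C M).comap (R ⋙ Q.Q)) ∧
        QuasiEquivalent ((homEnrichment C M).pushforward R Q Fib)
          ((homEnrichment C M).comap (R ⋙ Q.Q))) := by
  obtain ⟨A, hA⟩ := hmod.exists_adjointModule
  have h := hmod.isQuillenPair
  have h' := hmod.isQuillenPair'
  have hσ : (homEnrichment C M).IsModelEnrichment := isModelEnrichment_homEnrichment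
  have hτ : ((homEnrichment D N).mapLax G).IsModelEnrichment :=
    isModelEnrichment_homEnrichment_mapLax h
  have hτFib := quasiEquivalent_comap_fibrantReplacement hτ Fib
  have first : QuasiEquivalent ((homEnrichment C M).pushforward R Q Fib)
      ((homEnrichment D N).mapLax G) := by
    -- the enrichment `G Hom_D(Fib -, Fib -)` mediates between the two
    refine QuasiEquivalent.trans ?_ hτFib
    have hS : ((homEnrichment C M).pushforward R Q Fib).IsModelEnrichment := by
      refine hσ.comap _ (fun X _ ↦ Q.isCofibrant _) (fun X _ ↦ ?_) (fun f _ ↦ ?_)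
      · have := Fib.isFibrant X
        have := h'.isFibrant (Fib.Fib.obj X)
        exact Q.isFibrant _
      · have := Fib.isFibrant
        have := Fib.map_weakEquivalence f
        have := h'.map_weakEquivalence_right (Fib.Fib.map f)
        exact Q.map_weakEquivalence (R.map (Fib.Fib.map f))
    refine ((A.functorStruct.comap Fib.Fib).quasiEquivalent_comap
      (S := Fib.Fib ⋙ R ⋙ Q.Q) (Functor.whiskerLeft (Fib.Fib ⋙ R) Q.π)
      (let ⟨h, _⟩ := hτFib; h) hS (fun a b _ _ ↦ ?_) (fun a b _ _ ↦ ?_)).symm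
    · have := Fib.isCofibrant a
      have := Fib.isFibrant a
      have := Fib.isFibrant b
      have := Q.isCofibrant (R.obj (Fib.Fib.obj a))
      exact A.weakEquivalence_mapRight_map hA h h' (Q.π.app (R.obj (Fib.Fib.obj a)))
        (hequiv.homEquiv_symm_π Q _) (Fib.Fib.obj b)
    · have : IsCofibrant ((Fib.Fib ⋙ R ⋙ Q.Q).obj a) := Q.isCofibrant _
      exact Q.weakEquivalence_ehom_map _ _
  refine ⟨first, fun hR ↦ ?_⟩
  have second : QuasiEquivalent ((homEnrichment D N).mapLax G)
      ((homEnrichment C M).comap (R ⋙ Q.Q)) := by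
    have hS : ((homEnrichment C M).comap (R ⋙ Q.Q)).IsModelEnrichment := by
      refine hσ.comap _ (fun X _ ↦ Q.isCofibrant _) (fun X _ ↦ ?_) (fun f _ ↦ ?_)
      · have := h'.isFibrant X
        exact Q.isFibrant _
      · have := hR f inferInstance
        exact Q.map_weakEquivalence (R.map f)
    refine A.functorStruct.quasiEquivalent_comap (Functor.whiskerLeft R Q.π) hτ hS
      (fun a b _ _ ↦ ?_) (fun a b _ _ ↦ ?_)
    · have := Q.isCofibrant (R.obj a)
      exact A.weakEquivalence_mapRight_map hA h h' (Q.π.app (R.obj a))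
        (hequiv.homEquiv_symm_π_of_map_weakEquivalence Q Fib hR a) b
    · have : IsCofibrant ((R ⋙ Q.Q).obj a) := Q.isCofibrant _
      exact Q.weakEquivalence_ehom_map _ _
  exact ⟨second, first.trans second⟩
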